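/- Let $K$ be a commutative ring, $F$ a free group on finitely many generators, $d\ge 0$ an integer, and $M=(M_{i,j})\in M_d(KF)$ a $d\times d$ matrix with entries in the group algebra $KF$; for $a\in KF$ and $g\in F$ let $(a,g)\in K$ denote the coefficient of $g$ in $a$. Let $A$ be the alphabet of all triples $[g,i,j]$ with $1\le i,j\le d$, $g\in F$ and $(M_{i,j},g)\ne 0$. Define the noncommutative formal power series $S_M=\sum_{w\in A^*}(S_M,w)\,w\in K\langle\!\langle A\rangle\!\rangle$ as follows. For the empty word, $(S_M,1)=d$. For a nonempty word $w=[g_1,i_1,j_1]\cdots[g_n,i_n,j_n]$, put $$(S_M,w)=(M_{i_1,j_1},g_1)\cdots(M_{i_n,j_n},g_n)$$ if $j_k=i_{k+1}$ for all $1\le k<n$, $j_n=i_1$, and $g_1\cdots g_n=1$ in $F$; put $(S_M,w)=0$ otherwise. Then $S_M$ is algebraic. Here a series $S\in K\langle\!\langle A\rangle\!\rangle$ is called algebraic if there are an integer $n\ge 1$, noncommutative polynomials $p_1,\dots,p_n\in K\langle \xi_1,\dots,\xi_n,A\rangle$, none of which has a constant term or contains a monomial $\xi_j$ $(1\le j\le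 n)$, and series $S_1,\dots,S_n\in K\langle\!\langle A\rangle\!\rangle$ without constant terms satisfying $S_i=p_i(S_1,\dots,S_n,A)$ for all $i$, such that $S$ differs by a constant in $K$ from one of the $S_i$. -/

import Mathlib

/-- Noncommutative formal power series with coefficients in `K` on the alphabet `A`: a series is
the family of its coefficients, indexed by the words of the free monoid on `A`. -/
def NCSeries (K A : Type*) : Type _ := FreeMonoid A → K

namespace NCSeries

variable {K A : Type*}

/-- The coefficient `(S, w)` of the word `w` in the series `S`. -/
def coeff (S : NCSeries K A) (w : FreeMonoid A) : K := S w

@[ext]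
theorem ext {S T : NCSeries K A} (h : ∀ w, S.coeff w = T.coeff w) : S = T := funext h

/-- The left quotient of `S` by the letter `a`: its coefficient at `w` is `(S, a w)`. -/
def leftQuotient (a : A) (S : NCSeries K A) : NCSeries K A :=
  fun w => S.coeff (FreeMonoid.of a * w)

theorem coeff_leftQuotient (a : A) (S : NCSeries K A) (w : FreeMonoid A) :
    (leftQuotient a S).coeff w = S.coeff (FreeMonoid.of a * w) := rfl

section Ring

variable [CommRing K]

instance : AddCommGroup (NCSeries K A) := Pi.addCommGroup

open Classical in
/-- The unit series: the empty word with coefficient `1`. -/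
noncomputable instance : One (NCSeries K A) := ⟨fun w => if w = 1 then 1 else 0⟩

/-- The Cauchy product: `(S * T, w)` is the sum of `(S, u) (T, v)` over all factorizations
`w = u v`, each given by the length `k` of `u`. -/
instance : Mul (NCSeries K A) :=
  ⟨fun S T w => ∑ k ∈ Finset.range (w.toList.length + 1),
    S.coeff (FreeMonoid.ofList (w.toList.take k)) * T.coeff (FreeMonoid.ofList (w.toList.drop k))⟩

/-- Multiplication of all coefficients by a scalar. -/
instance : SMul K (NCSeries K A) := ⟨fun c S w => c * S.coeff w⟩

@[simp] theorem coeff_zero (w : FreeMonoid A) : (0 : NCSeries K A).coeff w = 0 := rfl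

@[simp] theorem coeff_add (S T : NCSeries K A) (w : FreeMonoid A) :
    (S + T).coeff w = S.coeff w + T.coeff w := rfl

@[simp] theorem coeff_smul (c : K) (S : NCSeries K A) (w : FreeMonoid A) :
    (c • S).coeff w = c * S.coeff w := rfl

open Classical in
theorem coeff_one (w : FreeMonoid A) :
    (1 : NCSeries K A).coeff w = if w = 1 then 1 else 0 := rfl

theorem coeff_mul (S T : NCSeries K A) (w : FreeMonoid A) :
    (S * T).coeff w = ∑ k ∈ Finset.range (w.toList.length + 1),
      S.coeff (FreeMonoid.ofList (w.toList.take k)) *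
        T.coeff (FreeMonoid.ofList (w.toList.drop k)) := rfl

theorem coeff_mul_empty (S T : NCSeries K A) :
    (S * T).coeff 1 = S.coeff 1 * T.coeff 1 := by
  simp [coeff_mul]

theorem coeff_mul_cons (S T : NCSeries K A) (a : A) (w : FreeMonoid A) :
    (S * T).coeff (FreeMonoid.of a * w) =
      S.coeff 1 * T.coeff (FreeMonoid.of a * w) + (leftQuotient a S * T).coeff w := by
  rw [coeff_mul, coeff_mul, add_comm (S.coeff 1 * _)]
  exact Finset.sum_range_succ' (fun k =>
    S.coeff (FreeMonoid.ofList ((a :: w.toList).take k)) *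
      T.coeff (FreeMonoid.ofList ((a :: w.toList).drop k))) (w.toList.length + 1)

theorem leftQuotient_mul (a : A) (S T : NCSeries K A) :
    leftQuotient a (S * T) = S.coeff 1 • leftQuotient a T + leftQuotient a S * T := by
  ext w
  rw [coeff_leftQuotient, coeff_mul_cons]
  rfl

protected theorem add_mul' (S T U : NCSeries K A) : (S + T) * U = S * U + T * U := by
  ext w
  simp only [coeff_mul, coeff_add, add_mul, Finset.sum_add_distrib]

protected theorem mul_add' (S T U : NCSeries K A) : S * (T + U) = S * T + S * U := by
  ext w
  simp only [coeff_mul, coeff_add, mul_add, Finset.sum_add_distrib]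

protected theorem smul_mul' (c : K) (S T : NCSeries K A) : (c • S) * T = c • (S * T) := by
  ext w
  simp only [coeff_mul, coeff_smul, Finset.mul_sum, mul_assoc]

protected theorem mul_smul' (c : K) (S T : NCSeries K A) : S * (c • T) = c • (S * T) := by
  ext w
  simp only [coeff_mul, coeff_smul, Finset.mul_sum, mul_left_comm]

protected theorem zero_mul' (S : NCSeries K A) : 0 * S = 0 := by
  ext w
  simp [coeff_mul]

protected theorem mul_zero' (S : NCSeries K A) : S * 0 = 0 := by
  ext w
  simp [coeff_mul]

protected theorem mul_assoc' (S T U : NCSeries K A) : S * T * U = S * (T * U) := by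
  ext w
  induction w using FreeMonoid.inductionOn' generalizing S with
  | one => simp only [coeff_mul_empty, mul_assoc]
  | of_mul a w ih =>
    rw [coeff_mul_cons, coeff_mul_cons, leftQuotient_mul, NCSeries.add_mul',
      NCSeries.smul_mul', coeff_add, coeff_smul, ih, coeff_mul_empty, coeff_mul_cons]
    ring

theorem leftQuotient_one (a : A) : leftQuotient a (1 : NCSeries K A) = 0 := by
  ext w
  rw [coeff_leftQuotient, coeff_one, if_neg, coeff_zero]
  intro h
  exact List.cons_ne_nil a w.toList h

protected theorem one_mul' (S : NCSeries K A) : 1 * S = S := by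
  ext w
  induction w using FreeMonoid.inductionOn' with
  | one => simp [coeff_mul_empty, coeff_one]
  | of_mul a w ih =>
    rw [coeff_mul_cons, leftQuotient_one, NCSeries.zero_mul']
    simp [coeff_one]

protected theorem mul_one' (S : NCSeries K A) : S * 1 = S := by
  ext w
  induction w using FreeMonoid.inductionOn' generalizing S with
  | one => simp [coeff_mul_empty, coeff_one]
  | of_mul a w ih =>
    rw [coeff_mul_cons, ih, ← coeff_leftQuotient, leftQuotient_one, coeff_leftQuotient]
    simp

noncomputable instance : Ring (NCSeries K A) :=
  { (inferInstance : AddCommGroup (NCSeries K A)) with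
    mul := (· * ·)
    one := 1
    left_distrib := NCSeries.mul_add'
    right_distrib := NCSeries.add_mul'
    zero_mul := NCSeries.zero_mul'
    mul_zero := NCSeries.mul_zero'
    mul_assoc := NCSeries.mul_assoc'
    one_mul := NCSeries.one_mul'
    mul_one := NCSeries.mul_one' }

instance : Module K (NCSeries K A) where
  one_smul S := by ext w; simp
  mul_smul c c' S := by ext w; simp [mul_assoc]
  smul_zero c := by ext w; simp
  smul_add c S T := by ext w; simp [mul_add]
  add_smul c c' S := by ext w; simp [add_mul]
  zero_smul S := by ext w; simp

/-- The `K`-algebra of noncommutative formal power series on `A`; the scalar `c` is the constant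
series `c • 1`. -/
noncomputable instance : Algebra K (NCSeries K A) :=
  Algebra.ofModule NCSeries.smul_mul' NCSeries.mul_smul'

open Classical in
/-- The letter `a` as a series. -/
noncomputable def letter (a : A) : NCSeries K A :=
  fun w => if w = FreeMonoid.of a then 1 else 0

/-- Noncommutative polynomials, with coefficients in `K`, in the unknowns `ξ₁, …, ξₙ`
(the letters `Sum.inl i`) and the letters of `A` (the letters `Sum.inr a`). -/
abbrev SystemPolynomial (K A : Type*) [CommRing K] (n : ℕ) : Type _ :=
  MonoidAlgebra K (FreeMonoid (Fin n ⊕ A))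

/-- The value `p(S₁, …, Sₙ, A)`: each unknown `ξᵢ` is replaced by the series `Sᵢ`, and each letter
of `A` by itself. -/
noncomputable def evalPolynomial {n : ℕ} (S : Fin n → NCSeries K A)
    (p : SystemPolynomial K A n) : NCSeries K A :=
  MonoidAlgebra.lift K (NCSeries K A) (FreeMonoid (Fin n ⊕ A))
    (FreeMonoid.lift (Sum.elim S letter)) p

/-- The system `ξᵢ = pᵢ` (`i = 1, …, n`) is proper: no `pᵢ` has a constant term or contains
a monomial `ξⱼ`. -/
def IsProperSystem {n : ℕ} (p : Fin n → SystemPolynomial K A n) : Prop :=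
  ∀ i, (p i).coeff 1 = 0 ∧ ∀ j, (p i).coeff (FreeMonoid.of (Sum.inl j)) = 0

/-- `(S₁, …, Sₙ)` is a solution, without constant terms, of the system `ξᵢ = pᵢ`. -/
def IsProperSolution {n : ℕ} (p : Fin n → SystemPolynomial K A n)
    (S : Fin n → NCSeries K A) : Prop :=
  ∀ i, S i = evalPolynomial S (p i) ∧ (S i).coeff 1 = 0

/-- A noncommutative series is algebraic if it differs by a constant from a component of the
solution of a system of proper algebraic noncommutative equations. -/
def IsAlgebraic (S : NCSeries K A) : Prop :=
  ∃ (n : ℕ) (p : Fin n → SystemPolynomial K A n) (T : Fin n → NCSeries K A),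
    IsProperSystem p ∧ IsProperSolution p T ∧
      ∃ (i : Fin n) (c : K), S = T i + algebraMap K (NCSeries K A) c

end Ring

end NCSeries

namespace Matrix

variable {K X : Type*} [CommRing K] {d : ℕ}

/-- The alphabet attached to a matrix `M` over the group algebra of a free group: the triples
`[g, i, j]` such that `g` appears in the `(i, j)`-entry of `M`. -/
structure Triple (M : Matrix (Fin d) (Fin d) (MonoidAlgebra K (FreeGroup X))) where
  /-- the group element `g` -/
  g : FreeGroup X
  /-- the row index `i` -/
  i : Fin d
  /-- the column index `j` -/
  j : Fin d
  /-- `g` appears in the entry `M i j` -/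
  coeff_ne_zero : (M i j).coeff g ≠ 0

variable {M : Matrix (Fin d) (Fin d) (MonoidAlgebra K (FreeGroup X))}

/-- The coefficient `(M i j, g)` attached to the triple `[g, i, j]`. -/
def Triple.weight (a : Triple M) : K := (M a.i a.j).coeff a.g

/-- The word `[g₁, i₁, j₁] ⋯ [gₙ, iₙ, jₙ]` is a closed path of indices: `j_k = i_{k+1}` for
`1 ≤ k < n`, and `jₙ = i₁`. -/
def IsClosedPath (w : FreeMonoid (Triple M)) : Prop :=
  (∀ (k : ℕ) (hk : k + 1 < w.toList.length), (w.toList[k]).j = (w.toList[k + 1]).i) ∧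
    ∀ h : w.toList ≠ [], (w.toList.getLast h).j = (w.toList.head h).i

open Classical in
/-- The series `S_M`. The coefficient of the empty word is `d`; the coefficient of a nonempty word
`[g₁, i₁, j₁] ⋯ [gₙ, iₙ, jₙ]` is the product of the `(M i_k j_k, g_k)` if the word is a closed path
of indices with `g₁ ⋯ gₙ = 1`, and `0` otherwise. -/
noncomputable def pathSeries (M : Matrix (Fin d) (Fin d) (MonoidAlgebra K (FreeGroup X))) :
    NCSeries K (Triple M) :=
  fun w =>
    if w = 1 then (d : K)
    else if IsClosedPath w ∧ (w.toList.map Triple.g).prod = 1 then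
      (w.toList.map Triple.weight).prod
    else 0

end Matrix

/-!
The algebraicity of `S_M` follows from a criterion and a geometric decomposition.

*Criterion* (`NCSeries.isAlgebraic_of_mem_adjoin`). Over a finite alphabet, let `s` be a finite set
of series such that every left quotient of a member of `s` by a letter lies in the subalgebra
generated by `s`. Then every series of this subalgebra is algebraic. Indeed, a series without
constant term is the sum over the letters `a` of `a` times its left quotient by `a`; writing the
left quotients as noncommutative polynomials in the generators (from which the constant terms have
been removed) gives a system whose monomials all start with a letter, hence a proper one.

*Decomposition.* A word on the alphabet of triples is read as a walk on the vertices `(p, i)`, with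
`p` in the free group: the letter `[g, i, j]` leads from `(p, i)` to `(p g, j)`. For a subset `C` of
the group, `walkSeries C p i q j` enumerates the walks from `(p, i)` to `(q, j)` whose vertices
before the last one all lie over `C`. Left quotients of such a series are multiples of series of
the same kind, with another starting point; so it suffices to express all of them through finitely
many. Let `L ≥ 1` bound the lengths of the group elements that occur in `M`, and let `C` be the
whole group or the cone of the reduced words beginning with a given letter. If the starting point
`p = u v` is long, with `v` its suffix of length `L`, then a walk from `p` to a point `q` of length
at most `L` has to leave the translate by `u` of the cone of the first letter of `v`. It does so at
a point `u r` with `r` shorter than `L`, because the free group is a tree: this is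
`FreeGroup.norm_lt_of_mem_prefixCone`. Cutting the walk at its first exit
(`walkSeries_eq_sum_mul`) gives products of a translate of a series with short starting point and
a series with starting point shorter than `p`, and induction on the length of `p` concludes
(`walkSeries_mem_adjoin`).
-/

/-! ### A criterion of algebraicity -/

namespace NCSeries

variable {K A : Type*} [CommRing K]

theorem leftQuotient_add (a : A) (S T : NCSeries K A) :
    leftQuotient a (S + T) = leftQuotient a S + leftQuotient a T := rfl

theorem leftQuotient_algebraMap (a : A) (c : K) :
    leftQuotient a (algebraMap K (NCSeries K A) c) = 0 := by
  rw [Algebra.algebraMap_eq_smul_one]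
  ext w
  have h : (leftQuotient a (1 : NCSeries K A)).coeff w = 0 := by
    rw [leftQuotient_one, coeff_zero]
  rw [coeff_leftQuotient] at h
  rw [coeff_leftQuotient, coeff_smul, h, mul_zero, coeff_zero]

theorem coeff_algebraMap_empty (c : K) : (algebraMap K (NCSeries K A) c).coeff 1 = c := by
  rw [Algebra.algebraMap_eq_smul_one, coeff_smul, coeff_one, if_pos rfl, mul_one]

theorem coeff_sum {ι : Type*} (s : Finset ι) (f : ι → NCSeries K A) (w : FreeMonoid A) :
    (∑ i ∈ s, f i).coeff w = ∑ i ∈ s, (f i).coeff w := by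
  classical
  induction s using Finset.induction_on with
  | empty => rfl
  | insert i s hi ih => rw [Finset.sum_insert hi, Finset.sum_insert hi, coeff_add, ih]

theorem coeff_letter_mul_empty (a : A) (S : NCSeries K A) :
    (letter a * S : NCSeries K A).coeff 1 = 0 := by
  have h : (letter a : NCSeries K A).coeff 1 = 0 :=
    if_neg fun h => List.cons_ne_nil a [] (congrArg FreeMonoid.toList h).symm
  rw [coeff_mul_empty, h, zero_mul]

open Classical in
theorem leftQuotient_letter (a b : A) :
    leftQuotient b (letter a : NCSeries K A) = if a = b then 1 else 0 := by
  ext w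
  rw [coeff_leftQuotient]
  change (if FreeMonoid.of b * w = FreeMonoid.of a then (1 : K) else 0) = _
  have h : FreeMonoid.of b * w = FreeMonoid.of a ↔ a = b ∧ w = 1 := by
    change b :: w.toList = [a] ↔ a = b ∧ w.toList = []
    rw [List.cons.injEq, eq_comm]
  by_cases hab : a = b <;> simp [h, hab, coeff_one]

open Classical in
theorem coeff_letter_mul_cons (a b : A) (S : NCSeries K A) (w : FreeMonoid A) :
    (letter a * S : NCSeries K A).coeff (FreeMonoid.of b * w) = if a = b then S.coeff w else 0 := by
  have h : (letter a : NCSeries K A).coeff 1 = 0 :=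
    if_neg fun h => List.cons_ne_nil a [] (congrArg FreeMonoid.toList h).symm
  rw [coeff_mul_cons, h, zero_mul, zero_add, leftQuotient_letter]
  split_ifs
  · rw [one_mul]
  · rw [zero_mul, coeff_zero]

theorem eq_sum_letter_mul_leftQuotient [Fintype A] {S : NCSeries K A} (hS : S.coeff 1 = 0) :
    S = ∑ a, letter a * leftQuotient a S := by
  classical
  ext w
  rw [coeff_sum]
  induction w using FreeMonoid.inductionOn' with
  | one => simp only [coeff_letter_mul_empty, hS, Finset.sum_const_zero]
  | of_mul b w => simp [coeff_letter_mul_cons, coeff_leftQuotient]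

theorem leftQuotient_mem_adjoin {s : Set (NCSeries K A)} {a : A}
    (h : ∀ S ∈ s, leftQuotient a S ∈ Algebra.adjoin K s) {S : NCSeries K A}
    (hS : S ∈ Algebra.adjoin K s) : leftQuotient a S ∈ Algebra.adjoin K s := by
  induction hS using Algebra.adjoin_induction with
  | mem S hS => exact h S hS
  | algebraMap c => rw [leftQuotient_algebraMap]; exact zero_mem _
  | add S T _ _ hS hT => rw [leftQuotient_add]; exact add_mem hS hT
  | mul S T _ hT' hS hT =>
    rw [leftQuotient_mul]
    exact add_mem (Subalgebra.smul_mem _ hT _) (mul_mem hS hT')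

theorem exists_evalPolynomial_eq {n : ℕ} {T : Fin n → NCSeries K A} {S : NCSeries K A}
    (hS : S ∈ Algebra.adjoin K (Set.range T)) :
    ∃ p : SystemPolynomial K A n, evalPolynomial T p = S := by
  suffices h : Algebra.adjoin K (Set.range T) ≤ (MonoidAlgebra.lift K (NCSeries K A)
      (FreeMonoid (Fin n ⊕ A)) (FreeMonoid.lift (Sum.elim T letter))).range from h hS
  rw [Algebra.adjoin_le_iff]
  rintro _ ⟨i, rfl⟩
  exact ⟨MonoidAlgebra.single (FreeMonoid.of (Sum.inl i)) 1, by simp⟩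

/-- Over a finite alphabet, the series of a finitely generated subalgebra that is stable under left
quotients are algebraic. -/
theorem isAlgebraic_of_mem_adjoin [Finite A] {s : Set (NCSeries K A)} (hs : s.Finite)
    (h : ∀ S ∈ s, ∀ a, leftQuotient a S ∈ Algebra.adjoin K s) {S : NCSeries K A}
    (hS : S ∈ Algebra.adjoin K s) : S.IsAlgebraic := by
  classical
  have := Fintype.ofFinite A
  -- With `S` added to the generators, `S` is a component of the system to be written.
  obtain ⟨n, T₀, hT₀⟩ : ∃ (n : ℕ) (T₀ : Fin n → NCSeries K A), Set.range T₀ = insert S s := by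
    obtain ⟨n, f, -, hf⟩ := (hs.insert S).fin_param
    exact ⟨n, f, hf⟩
  have hadj : ∀ R ∈ insert S s, R ∈ Algebra.adjoin K s := by
    rintro R (rfl | hR)
    · exact hS
    · exact Algebra.subset_adjoin hR
  set T : Fin n → NCSeries K A := fun i => T₀ i - algebraMap K _ ((T₀ i).coeff 1) with hT
  have hT_add : ∀ i, T₀ i = T i + algebraMap K _ ((T₀ i).coeff 1) :=
    fun i => (sub_add_cancel _ _).symm
  have hT_empty : ∀ i, (T i).coeff 1 = 0 := by
    intro i
    have := congrArg (coeff · 1) (hT_add i)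
    simpa only [coeff_add, coeff_algebraMap_empty, right_eq_add] using this
  have hle : Algebra.adjoin K s ≤ Algebra.adjoin K (Set.range T) := by
    refine Algebra.adjoin_le fun R hR => ?_
    obtain ⟨i, rfl⟩ : R ∈ Set.range T₀ := hT₀ ▸ Set.mem_insert_of_mem S hR
    rw [SetLike.mem_coe, hT_add i]
    exact add_mem (Algebra.subset_adjoin (Set.mem_range_self i)) (algebraMap_mem _ _)
  have hquot : ∀ i a, leftQuotient a (T i) ∈ Algebra.adjoin K (Set.range T) := by
    intro i a
    refine hle (leftQuotient_mem_adjoin (fun R hR => h R hR a) ?_)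
    exact sub_mem (hadj _ (hT₀ ▸ Set.mem_range_self i)) (algebraMap_mem _ _)
  choose Q hQ using fun i a => exists_evalPolynomial_eq (hquot i a)
  obtain ⟨i₀, hi₀⟩ : S ∈ Set.range T₀ := hT₀ ▸ Set.mem_insert S s
  refine ⟨n, fun i => ∑ a, MonoidAlgebra.single (FreeMonoid.of (Sum.inr a)) 1 * Q i a, T,
    fun i => ?_, fun i => ⟨?_, hT_empty i⟩, i₀, (T₀ i₀).coeff 1, hi₀ ▸ hT_add i₀⟩
  · have hcoeff : ∀ w : FreeMonoid (Fin n ⊕ A), (∀ a v, FreeMonoid.of (Sum.inr a) * v ≠ w) →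
        (∑ a, MonoidAlgebra.single (FreeMonoid.of (Sum.inr a)) (1 : K) * Q i a).coeff w = 0 := by
      intro w hw
      rw [MonoidAlgebra.coeff_sum, Finsupp.finsetSum_apply]
      exact Finset.sum_eq_zero fun a _ =>
        MonoidAlgebra.coeff_single_mul_of_forall_mul_ne _ _ (hw a)
    refine ⟨hcoeff 1 fun a v hv => List.cons_ne_nil _ v.toList hv,
      fun j => hcoeff _ fun a v hv => ?_⟩
    exact Sum.inr_ne_inl (List.cons.inj (congrArg FreeMonoid.toList hv)).1
  · conv_lhs => rw [eq_sum_letter_mul_leftQuotient (hT_empty i)]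
    simp only [evalPolynomial] at hQ ⊢
    simp only [map_sum, map_mul, hQ, MonoidAlgebra.lift_single, FreeMonoid.lift_eval_of,
      Sum.elim_inr, one_smul]

end NCSeries

/-! ### Cones in the free group -/

namespace FreeGroup

variable {X : Type*} [DecidableEq X]

theorem finite_norm_le [Finite X] (n : ℕ) : {g : FreeGroup X | g.norm ≤ n}.Finite :=
  (List.finite_length_le (X × Bool) n).preimage toWord_injective.injOn

/-- The elements of the free group whose reduced word begins with `l`. It is the whole group for
`l = []`. -/
def prefixCone (l : List (X × Bool)) : Set (FreeGroup X) := {g | l <+: g.toWord}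

theorem mem_prefixCone {l : List (X × Bool)} {g : FreeGroup X} :
    g ∈ prefixCone l ↔ l <+: g.toWord := Iff.rfl

theorem prefixCone_nil : prefixCone ([] : List (X × Bool)) = Set.univ :=
  Set.eq_univ_of_forall fun _ => List.nil_prefix

/-- Reduced words that begin with different letters do not interact in `h⁻¹ * h'`. -/
theorem norm_inv_mul_of_mem_prefixCone {x : X × Bool} {h h' : FreeGroup X}
    (hh : h ∈ prefixCone [x]) (hh' : h' ∉ prefixCone [x]) :
    (h⁻¹ * h').norm = h.norm + h'.norm := by
  obtain ⟨t, ht⟩ := hh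
  have hred : IsReduced (h⁻¹.toWord ++ h'.toWord) := by
    refine List.IsChain.append isReduced_toWord isReduced_toWord ?_
    intro y hy z hz
    rw [toWord_inv, ← ht] at hy
    have hy' : y = (x.1, !x.2) := by
      simp [invRev] at hy
      exact hy.symm
    have hzx : z ≠ x := by
      rintro rfl
      apply hh'
      rw [mem_prefixCone]
      cases hw : h'.toWord with
      | nil => simp [hw] at hz
      | cons b t => simp [hw] at hz; simp [hz]
    subst hy'
    intro h1
    by_contra h2
    refine hzx (Prod.ext h1.symm ?_)
    simpa using Ne.symm h2
  rw [norm, toWord_mul, hred.reduce_eq, List.length_append, toWord_inv, invRev_length]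
  rfl

/-- A step of length at most `L` out of a cone ends at a point of length less than `L`: the step
has to traverse the edge at which the cone is attached. -/
theorem norm_lt_of_mem_prefixCone {x : X × Bool} {h g : FreeGroup X} {L : ℕ}
    (hh : h ∈ prefixCone [x]) (hg : g.norm ≤ L) (hhg : h * g ∉ prefixCone [x]) :
    (h * g).norm < L := by
  have h1 := norm_inv_mul_of_mem_prefixCone hh hhg
  rw [inv_mul_cancel_left] at h1
  have h2 : 0 < h.norm := by
    have := hh.length_le
    simp only [List.length_singleton] at this
    exact this
  omega

theorem toWord_mk_mul_of_isReduced {u : List (X × Bool)} {x : X × Bool}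
    (hu : IsReduced (u ++ [x])) {h : FreeGroup X} (hh : h ∈ prefixCone [x]) :
    (mk u * h).toWord = u ++ h.toWord := by
  obtain ⟨t, ht⟩ := hh
  have hr : IsReduced (u ++ h.toWord) := by
    have h1 : IsReduced ([x] ++ t) := ht ▸ isReduced_toWord
    rw [← ht, ← List.append_assoc]
    exact hu.append_overlap h1 (by simp)
  rw [← mk_toWord (x := h), mul_mk, toWord_mk, mk_toWord, hr.reduce_eq]

end FreeGroup

/-! ### Series of walks -/

namespace Matrix

open NCSeries FreeGroup

variable {K X : Type*} [CommRing K] {d : ℕ}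

theorem finite_triple (M : Matrix (Fin d) (Fin d) (MonoidAlgebra K (FreeGroup X))) :
    Finite (Triple M) := by
  let f : Triple M → Σ ij : Fin d × Fin d, (M ij.1 ij.2).coeff.support :=
    fun a => ⟨(a.i, a.j), a.g, Finsupp.mem_support_iff.2 a.coeff_ne_zero⟩
  refine Finite.of_injective f ?_
  rintro ⟨g, i, j, h⟩ ⟨g', i', j', h'⟩ hf
  simp only [f, Sigma.mk.injEq, Prod.mk.injEq] at hf
  obtain ⟨⟨rfl, rfl⟩, hg⟩ := hf
  simpa using hg

variable {M : Matrix (Fin d) (Fin d) (MonoidAlgebra K (FreeGroup X))}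

open Classical in
/-- The weight of a list of triples read as a walk from `(p, i)`, where the triple `[g, i, j]`
leads from `(p, i)` to `(p * g, j)`: the product of the weights of its letters if this is a walk
that ends at `(q, j)` and all of whose earlier vertices lie over `C`, and `0` otherwise. -/
noncomputable def walkWeight (C : Set (FreeGroup X)) (q : FreeGroup X) (j : Fin d) :
    List (Triple M) → FreeGroup X → Fin d → K
  | [], p, i => if p = q ∧ i = j then 1 else 0
  | a :: w, p, i => if p ∈ C ∧ a.i = i then a.weight * walkWeight C q j w (p * a.g) a.j else 0

/-- The series of the walks from `(p, i)` to `(q, j)` all of whose vertices before the last one lie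
over `C`. The last vertex may lie over `C` or not. -/
noncomputable def walkSeries (M : Matrix (Fin d) (Fin d) (MonoidAlgebra K (FreeGroup X)))
    (C : Set (FreeGroup X)) (p : FreeGroup X) (i : Fin d) (q : FreeGroup X) (j : Fin d) :
    NCSeries K (Triple M) :=
  fun w => walkWeight C q j w.toList p i

open Classical in
theorem coeff_walkSeries_empty (C : Set (FreeGroup X)) (p q : FreeGroup X) (i j : Fin d) :
    (walkSeries M C p i q j).coeff 1 = if p = q ∧ i = j then 1 else 0 := rfl

open Classical in
theorem leftQuotient_walkSeries (C : Set (FreeGroup X)) (p q : FreeGroup X) (i j : Fin d)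
    (a : Triple M) :
    leftQuotient a (walkSeries M C p i q j) =
      if p ∈ C ∧ a.i = i then a.weight • walkSeries M C (p * a.g) a.j q j else 0 := by
  ext w
  split_ifs with h
  · exact if_pos h
  · exact if_neg h

open Classical in
theorem walkSeries_of_notMem {C : Set (FreeGroup X)} {p : FreeGroup X} (hp : p ∉ C)
    (q : FreeGroup X) (i j : Fin d) :
    walkSeries M C p i q j = if p = q ∧ i = j then 1 else 0 := by
  ext w
  induction w using FreeMonoid.inductionOn' with
  | one => rw [coeff_walkSeries_empty]; split_ifs <;> simp [coeff_one]
  | of_mul a w =>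
    rw [← coeff_leftQuotient, ← coeff_leftQuotient, leftQuotient_walkSeries,
      if_neg fun h => hp h.1]
    split_ifs
    · rw [leftQuotient_one]
    · rfl

theorem walkSeries_translate (C : Set (FreeGroup X)) (u p q : FreeGroup X) (i j : Fin d) :
    walkSeries M {g | u⁻¹ * g ∈ C} (u * p) i (u * q) j = walkSeries M C p i q j := by
  classical
  ext w
  induction w using FreeMonoid.inductionOn' generalizing p i with
  | one => simp [coeff_walkSeries_empty]
  | of_mul a w ih =>
    rw [← coeff_leftQuotient, ← coeff_leftQuotient, leftQuotient_walkSeries,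
      leftQuotient_walkSeries]
    simp only [Set.mem_ofPred_eq, inv_mul_cancel_left]
    split_ifs
    · rw [coeff_smul, coeff_smul, mul_assoc, ih]
    · rfl

/-- Decomposition of walks at the first exit from a subset `C'` of `C`. The finite set `B` contains
all points at which a walk can leave `C'`. -/
theorem walkSeries_eq_sum_mul {C C' : Set (FreeGroup X)} (hC : C' ⊆ C) {B : Finset (FreeGroup X)}
    (hB : ∀ r ∈ B, r ∉ C') (hstep : ∀ p ∈ C', ∀ a : Triple M, p * a.g ∉ C' → p * a.g ∈ B)
    {q : FreeGroup X} (hq : q ∉ C') {p : FreeGroup X} (hp : p ∈ C' ∨ p ∈ B) (i j : Fin d) :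
    walkSeries M C p i q j =
      ∑ r ∈ B, ∑ l, walkSeries M C' p i r l * walkSeries M C r l q j := by
  classical
  have boundary : ∀ p ∈ B, ∀ i, walkSeries M C p i q j =
      ∑ r ∈ B, ∑ l, walkSeries M C' p i r l * walkSeries M C r l q j := by
    intro p hp i
    rw [Finset.sum_eq_single_of_mem p hp, Finset.sum_eq_single_of_mem i (Finset.mem_univ i)]
    · simp [walkSeries_of_notMem (hB p hp)]
    · intro l _ hl
      simp [walkSeries_of_notMem (hB p hp), hl.symm]
    · intro r _ hr
      simp [walkSeries_of_notMem (hB p hp), hr.symm]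
  ext w
  induction w using FreeMonoid.inductionOn' generalizing p i with
  | one =>
    rcases hp with hp | hp
    · have hpq : p ≠ q := fun h => hq (h ▸ hp)
      have hpr : ∀ r ∈ B, p ≠ r := fun r hr h => hB r hr (h ▸ hp)
      simp only [coeff_sum, coeff_mul_empty]
      rw [coeff_walkSeries_empty, if_neg fun h => hpq h.1, eq_comm]
      refine Finset.sum_eq_zero fun r hr => Finset.sum_eq_zero fun l _ => ?_
      rw [coeff_walkSeries_empty, if_neg fun h => hpr r hr h.1, zero_mul]
    · rw [← boundary p hp]
  | of_mul a w ih =>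
    rcases hp with hp | hp
    · have hpr : ∀ r ∈ B, p ≠ r := fun r hr h => hB r hr (h ▸ hp)
      have key : ∀ r ∈ B, ∀ l, (walkSeries M C' p i r l * walkSeries M C r l q j).coeff
          (FreeMonoid.of a * w) = if a.i = i then a.weight *
            (walkSeries M C' (p * a.g) a.j r l * walkSeries M C r l q j).coeff w else 0 := by
        intro r hr l
        rw [coeff_mul_cons, coeff_walkSeries_empty, if_neg fun h => hpr r hr h.1, zero_mul,
          zero_add, leftQuotient_walkSeries]
        simp only [hp, true_and]
        split_ifs
        · rw [smul_mul_assoc, coeff_smul]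
        · rw [zero_mul, coeff_zero]
      simp only [coeff_sum]
      rw [Finset.sum_congr rfl fun r hr => Finset.sum_congr rfl fun l _ => key r hr l,
        ← coeff_leftQuotient, leftQuotient_walkSeries]
      simp only [hC hp, true_and]
      split_ifs
      · have hnext : p * a.g ∈ C' ∨ p * a.g ∈ B := by
          by_cases h : p * a.g ∈ C'
          · exact Or.inl h
          · exact Or.inr (hstep p hp a h)
        rw [coeff_smul, ih hnext]
        simp only [coeff_sum, Finset.mul_sum]
      · simp
    · rw [← boundary p hp]

/-! ### Finitely many series of walks suffice -/

/-- The series of walks in the whole group or in the cone of a letter that start at distance at most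
`2 * L` from the origin and end at distance at most `L`. -/
def shortWalkSeries [DecidableEq X]
    (M : Matrix (Fin d) (Fin d) (MonoidAlgebra K (FreeGroup X))) (L : ℕ) :
    Set (NCSeries K (Triple M)) :=
  {S | ∃ l p i q j, List.length l ≤ 1 ∧ FreeGroup.norm p ≤ 2 * L ∧ FreeGroup.norm q ≤ L ∧
    S = walkSeries M (prefixCone l) p i q j}

theorem finite_shortWalkSeries [DecidableEq X] [Finite X] (L : ℕ) :
    (shortWalkSeries M L).Finite := by
  have h := ((List.finite_length_le (X × Bool) 1).prod ((finite_norm_le (X := X) (2 * L)).prod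
    ((Set.finite_univ (α := Fin d)).prod ((finite_norm_le (X := X) L).prod
      (Set.finite_univ (α := Fin d)))))).image
        fun t => walkSeries M (prefixCone t.1) t.2.1 t.2.2.1 t.2.2.2.1 t.2.2.2.2
  refine h.subset ?_
  rintro _ ⟨l, p, i, q, j, hl, hp, hq, rfl⟩
  exact ⟨(l, p, i, q, j), ⟨hl, hp, trivial, hq, trivial⟩, rfl⟩

theorem walkSeries_mem_adjoin [DecidableEq X] [Finite X] {L : ℕ} (hL : 0 < L)
    (hM : ∀ a : Triple M, a.g.norm ≤ L) {l : List (X × Bool)} (hl : l.length ≤ 1)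
    {q : FreeGroup X} (hq : q.norm ≤ L) (j : Fin d) (p : FreeGroup X) (i : Fin d) :
    walkSeries M (prefixCone l) p i q j ∈ Algebra.adjoin K (shortWalkSeries M L) := by
  classical
  induction hn : p.norm using Nat.strong_induction_on generalizing p i with
  | _ n ih =>
  subst hn
  by_cases hp : p.norm ≤ 2 * L
  · exact Algebra.subset_adjoin ⟨l, p, i, q, j, hl, hp, hq, rfl⟩
  by_cases hpl : p ∈ prefixCone l
  swap
  · rw [walkSeries_of_notMem hpl]
    split_ifs
    · exact one_mem _
    · exact zero_mem _
  -- The reduced word of `p` is `u ++ x :: v`, where `x :: v` has length `L`.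
  obtain ⟨u, x, v, hpw, hv⟩ : ∃ u x v, p.toWord = u ++ x :: v ∧ (x :: v).length = L := by
    have hlen : (p.toWord.drop (p.norm - L)).length = L := by
      rw [List.length_drop]
      change p.norm - (p.norm - L) = L
      omega
    cases hd : p.toWord.drop (p.norm - L) with
    | nil => simp [hd] at hlen; omega
    | cons x v =>
      exact ⟨p.toWord.take (p.norm - L), x, v, by rw [← hd, List.take_append_drop], hd ▸ hlen⟩
  have hnorm : p.norm = u.length + L := by
    rw [← hv, ← List.length_append, ← hpw]
    rfl
  have hred : IsReduced (u ++ x :: v) := hpw ▸ isReduced_toWord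
  have hux : IsReduced (u ++ [x]) := hred.infix ⟨[], v, by simp⟩
  have hxv : (mk (x :: v)).toWord = x :: v := by
    rw [toWord_mk, IsReduced.reduce_eq (hred.infix ⟨u, [], by simp⟩)]
  have hpmul : p = mk u * mk (x :: v) := by rw [mul_mk, ← hpw, mk_toWord]
  have hlu : l <+: u :=
    List.prefix_of_prefix_length_le (hpw ▸ mem_prefixCone.1 hpl) (List.prefix_append u _) (by omega)
  have hB : {r : FreeGroup X | (mk u)⁻¹ * r ∉ prefixCone [x] ∧ ((mk u)⁻¹ * r).norm < L}.Finite :=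
    ((finite_norm_le L).preimage (mul_right_injective (mk u)⁻¹).injOn).subset
      fun r hr => hr.2.le
  have hmul : ∀ {g}, (mk u)⁻¹ * g ∈ prefixCone [x] → g.toWord = u ++ ((mk u)⁻¹ * g).toWord := by
    intro g hg
    rw [← toWord_mk_mul_of_isReduced hux hg, mul_inv_cancel_left]
  rw [walkSeries_eq_sum_mul (C' := {g | (mk u)⁻¹ * g ∈ prefixCone [x]}) (B := hB.toFinset)]
  · refine sum_mem fun r hr => sum_mem fun k _ => mul_mem ?_ ?_
    · obtain ⟨-, hr⟩ := hB.mem_toFinset.1 hr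
      rw [hpmul, ← mul_inv_cancel_left (mk u) r, walkSeries_translate]
      refine Algebra.subset_adjoin ⟨[x], _, i, _, k, le_rfl, ?_, hr.le, rfl⟩
      rw [FreeGroup.norm, hxv, hv]
      omega
    · obtain ⟨-, hr⟩ := hB.mem_toFinset.1 hr
      refine ih r.norm ?_ r k rfl
      calc r.norm = (mk u * ((mk u)⁻¹ * r)).norm := by rw [mul_inv_cancel_left]
        _ ≤ (mk u).norm + ((mk u)⁻¹ * r).norm := norm_mul_le _ _
        _ < u.length + L := add_lt_add_of_le_of_lt norm_mk_le hr
        _ = p.norm := hnorm.symm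
  · intro g hg
    rw [mem_prefixCone, hmul hg]
    exact hlu.trans (List.prefix_append _ _)
  · exact fun r hr => (hB.mem_toFinset.1 hr).1
  · intro g hg a hga
    rw [Set.mem_ofPred_eq, ← mul_assoc] at hga
    rw [hB.mem_toFinset, Set.mem_ofPred_eq, ← mul_assoc]
    exact ⟨hga, norm_lt_of_mem_prefixCone hg (hM a) hga⟩
  · -- A point of the translated cone is longer than `u`, hence longer than `L`.
    intro hqC
    have := congrArg List.length (hmul hqC)
    rw [List.length_append] at this
    change q.norm = _ at this
    omega
  · left
    rw [hpmul, Set.mem_ofPred_eq, inv_mul_cancel_left, mem_prefixCone, hxv]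
    exact ⟨v, rfl⟩

/-! ### The path series -/

open Classical in
theorem walkWeight_univ_cons (q : FreeGroup X) (j : Fin d) (a : Triple M) (w : List (Triple M))
    (p : FreeGroup X) (i : Fin d) :
    walkWeight Set.univ q j (a :: w) p i =
      if a.i = i ∧ (a :: w).IsChain (fun b c => b.j = c.i) ∧
          ((a :: w).getLast (List.cons_ne_nil a w)).j = j ∧
          p * ((a :: w).map Triple.g).prod = q
        then ((a :: w).map Triple.weight).prod else 0 := by
  induction w generalizing a p i with
  | nil =>
    simp only [walkWeight]
    by_cases h1 : a.i = i <;> by_cases h2 : a.j = j <;> by_cases h3 : p * a.g = q <;>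
      simp [h1, h2, h3]
  | cons b w ih =>
    rw [walkWeight, ih]
    simp only [Set.mem_univ, true_and, List.isChain_cons_cons, List.map_cons, List.prod_cons,
      List.getLast_cons_cons, mul_assoc]
    by_cases h1 : a.i = i
    · by_cases h2 : a.j = b.i
      · simp only [h1, h2, true_and, if_true, mul_ite, mul_zero]
      · simp only [h1, h2, Ne.symm h2, false_and, and_false, if_true, if_false, mul_zero]
    · simp only [h1, false_and, if_false]

theorem pathSeries_eq_sum_walkSeries :
    pathSeries M = ∑ i, walkSeries M Set.univ 1 i 1 i := by
  classical
  ext w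
  rw [coeff_sum]
  induction w using FreeMonoid.inductionOn' with
  | one =>
    have h : (pathSeries M).coeff 1 = (d : K) := if_pos rfl
    simp [coeff_walkSeries_empty, h]
  | of_mul a w =>
    have hne : FreeMonoid.of a * w ≠ 1 := List.cons_ne_nil a w.toList
    have hw : ∀ i, (walkSeries M Set.univ 1 i 1 i).coeff (FreeMonoid.of a * w) =
        walkWeight Set.univ 1 i (a :: w.toList) 1 i := fun i => rfl
    have hpath : IsClosedPath (FreeMonoid.of a * w) ↔
        (a :: w.toList).IsChain (fun b c => b.j = c.i) ∧
          ((a :: w.toList).getLast (List.cons_ne_nil a w.toList)).j = a.i := by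
      rw [List.isChain_iff_getElem]
      exact and_congr Iff.rfl ⟨fun h => h (List.cons_ne_nil a w.toList), fun h _ => h⟩
    rw [Finset.sum_eq_single_of_mem a.i (Finset.mem_univ _), hw, walkWeight_univ_cons]
    · change (if FreeMonoid.of a * w = 1 then (d : K)
        else if IsClosedPath (FreeMonoid.of a * w) ∧ ((a :: w.toList).map Triple.g).prod = 1 then
          ((a :: w.toList).map Triple.weight).prod else 0) = _
      rw [if_neg hne, hpath, one_mul]
      simp only [true_and, and_assoc]
    · intro i _ hi
      rw [hw, walkWeight_univ_cons, if_neg fun h => hi h.1.symm]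

end Matrix

theorem proposition4p3 {K : Type*} [CommRing K] {X : Type*} [Finite X] {d : ℕ}
    (M : Matrix (Fin d) (Fin d) (MonoidAlgebra K (FreeGroup X))) :
    (Matrix.pathSeries M).IsAlgebraic := by
  classical
  have := Matrix.finite_triple M
  obtain ⟨N, hN⟩ := (Set.finite_range fun a : Matrix.Triple M => a.g.norm).bddAbove
  have hM : ∀ a : Matrix.Triple M, a.g.norm ≤ N + 1 :=
    fun a => (hN (Set.mem_range_self a)).trans N.le_succ
  refine NCSeries.isAlgebraic_of_mem_adjoin (Matrix.finite_shortWalkSeries (M := M) (N + 1)) ?_ ?_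
  · rintro _ ⟨l, p, i, q, j, hl, -, hq, rfl⟩ a
    rw [Matrix.leftQuotient_walkSeries]
    split_ifs
    · exact Subalgebra.smul_mem _
        (Matrix.walkSeries_mem_adjoin N.succ_pos hM hl hq j _ _) _
    · exact zero_mem _
  · rw [Matrix.pathSeries_eq_sum_walkSeries, ← FreeGroup.prefixCone_nil]
    exact sum_mem fun i _ => Matrix.walkSeries_mem_adjoin N.succ_pos hM (l := []) (Nat.zero_le 1)
      (by simp) i 1 i
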